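/- Theorem. For $n\notin\{2,3,5\}$, let $\psi_3(n)$ denote the maximum of the sum of side lengths $\sum_{i=1}^n s_i$ over all tilings of the unit square $[0,1]^2$ by $n$ squares of side lengths $s_1,\dots,s_n>0$ whose sides are parallel to the sides of the unit square (a tiling is a family of squares with pairwise disjoint interiors whose union is exactly the unit square). Then $$\psi_3(8)=\frac{13}{5}.$$ That is, the maximum is attained for $n=8$: every tiling of the unit square by 8 axis-parallel squares has sum of side lengths at most $13/5$, and some such tiling has sum exactly $13/5$. -/

import Mathlib

open Set

/-- A tile: an axis-parallel square in the plane, given by its lower left corner `(x, y)` and its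
(positive) side length. -/
structure Tile where
  x : ℝ
  y : ℝ
  side : ℝ
  side_pos : 0 < side

/-- The closed region `[x, x + s] × [y, y + s]` of the plane occupied by a tile of side `s`. -/
def Tile.region (T : Tile) : Set (ℝ × ℝ) :=
  Icc T.x (T.x + T.side) ×ˢ Icc T.y (T.y + T.side)

/-- The closed unit square with corners `(0, 0)`, `(1, 0)`, `(0, 1)`, `(1, 1)`. -/
def unitSquare : Set (ℝ × ℝ) := Icc (0 : ℝ) 1 ×ˢ Icc (0 : ℝ) 1

/-- The `n` tiles `C 0, …, C (n - 1)` form a tiling of the unit square: no two of them overlap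
(their interiors are disjoint), and together they fill exactly the unit square. -/
structure IsTiling {n : ℕ} (C : Fin n → Tile) : Prop where
  disjoint_interior :
    Pairwise fun i j => Disjoint (interior (C i).region) (interior (C j).region)
  iUnion_eq : ⋃ i, (C i).region = unitSquare

/-- The total side length of a finite family of tiles. -/
def totalSide {n : ℕ} (C : Fin n → Tile) : ℝ := ∑ i, (C i).side

/-- All total side lengths of tilings of the unit square by exactly `n` axis-parallel squares. -/
def tilingSums (n : ℕ) : Set ℝ := {σ | ∃ C : Fin n → Tile, IsTiling C ∧ totalSide C = σ}

/-- `psi3 n` is the largest total side length of a tiling of the unit square by `n` axis-parallel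
squares, written as a supremum; it is a maximum when it is attained. -/
noncomputable def psi3 (n : ℕ) : ℝ := sSup (tilingSums n)

/-!
Every tiling of the unit square by eight squares has total side length at most `13 / 5`, and the
tiling `eightTiling` attains this value.

The squares along the boundary form a *frame* (`IsFrame`): four different corner squares and, on each
side, a run of further squares between the corners; the side lengths along each side add up to `1`.
As there are eight squares, at most four lie between the corners. Up to the symmetries of the unit
square (`transpose`, `reflect`) this leaves three kinds of frames.

* Each side meets exactly three squares (`IsFrame.sum_le_of_three_squares`).
* Two adjacent sides meet two squares each (`IsFrame.sum_le_of_adjacent`). Two opposite sides with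
  two squares each would force four corner squares of side `1 / 2` (`IsFrame.false_of_opposite`).
* Exactly one side meets two squares (`IsFrame.sum_le_of_bottom_two`).

In each of them the positions of the squares on the boundary are linear expressions in the side
lengths. The tool that determines the tiling is `IsSquareTiling.exists_corner`: where a square rises
above its neighbour, the inner corner is the lower left corner of another square. Only very few of
the eight squares can be this one, and each possibility is a linear equation between side lengths;
that two given squares do not overlap supplies the inequalities. In a few cases the squares found
so far already have total area `1`, or all eight have less (`IsSquareTiling.sum_sq`). In this way each
frame is either impossible or leaves at most one free side length, in terms of which the total side length
and its bound are explicit.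
-/

/-! ### Tilings in coordinates -/

/-- A tiling of the unit square by axis-parallel squares in coordinates: the square with index `i`
is `[x i, x i + s i] × [y i, y i + s i]`. Non-overlap says that any two of the squares are separated
by a horizontal or a vertical line. -/
structure IsSquareTiling {ι : Type*} (x y s : ι → ℝ) : Prop where
  pos : ∀ i, 0 < s i
  x_nonneg : ∀ i, 0 ≤ x i
  y_nonneg : ∀ i, 0 ≤ y i
  x_le : ∀ i, x i + s i ≤ 1
  y_le : ∀ i, y i + s i ≤ 1
  cover : ∀ u ∈ Icc (0 : ℝ) 1, ∀ v ∈ Icc (0 : ℝ) 1,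
    ∃ i, x i ≤ u ∧ u ≤ x i + s i ∧ y i ≤ v ∧ v ≤ y i + s i
  separated : ∀ i j, i ≠ j →
    x i + s i ≤ x j ∨ x j + s j ≤ x i ∨ y i + s i ≤ y j ∨ y j + s j ≤ y i

theorem IsTiling.isSquareTiling {n : ℕ} {C : Fin n → Tile} (hC : IsTiling C) :
    IsSquareTiling (fun i => (C i).x) (fun i => (C i).y) (fun i => (C i).side) := by
  have hsub : ∀ i, (C i).region ⊆ unitSquare := fun i => by
    rw [← hC.iUnion_eq]; exact subset_iUnion (fun i => (C i).region) i
  have hlow : ∀ i, ((C i).x, (C i).y) ∈ unitSquare := fun i => hsub i <| by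
    have := (C i).side_pos
    simp [Tile.region, this.le]
  have hupp : ∀ i, ((C i).x + (C i).side, (C i).y + (C i).side) ∈ unitSquare := fun i => hsub i <| by
    have := (C i).side_pos
    simp [Tile.region, this.le]
  refine ⟨fun i => (C i).side_pos, fun i => (hlow i).1.1, fun i => (hlow i).2.1,
    fun i => (hupp i).1.2, fun i => (hupp i).2.2, fun u hu v hv => ?_, fun i j hij => ?_⟩
  · have : (u, v) ∈ ⋃ i, (C i).region := by rw [hC.iUnion_eq]; exact ⟨hu, hv⟩
    obtain ⟨i, hi⟩ := mem_iUnion.1 this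
    exact ⟨i, hi.1.1, hi.1.2, hi.2.1, hi.2.2⟩
  · by_contra! hcon
    obtain ⟨h1, h2, h3, h4⟩ := hcon
    have hi := (C i).side_pos
    have hj := (C j).side_pos
    obtain ⟨u, hu, hu'⟩ := exists_between
      (show max (C i).x (C j).x < min ((C i).x + (C i).side) ((C j).x + (C j).side) by
        simp only [max_lt_iff, lt_min_iff]; exact ⟨⟨by linarith, h1⟩, h2, by linarith⟩)
    obtain ⟨v, hv, hv'⟩ := exists_between
      (show max (C i).y (C j).y < min ((C i).y + (C i).side) ((C j).y + (C j).side) by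
        simp only [max_lt_iff, lt_min_iff]; exact ⟨⟨by linarith, h3⟩, h4, by linarith⟩)
    simp only [max_lt_iff, lt_min_iff] at hu hu' hv hv'
    refine (hC.disjoint_interior hij).notMem_of_mem_left (a := (u, v)) ?_ ?_ <;>
      rw [Tile.region, interior_prod_eq, interior_Icc, interior_Icc]
    · exact ⟨⟨hu.1, hu'.1⟩, hv.1, hv'.1⟩
    · exact ⟨⟨hu.2, hu'.2⟩, hv.2, hv'.2⟩

namespace IsSquareTiling

variable {ι : Type*} {x y s : ι → ℝ}

theorem transpose (h : IsSquareTiling x y s) : IsSquareTiling y x s where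
  pos := h.pos
  x_nonneg := h.y_nonneg
  y_nonneg := h.x_nonneg
  x_le := h.y_le
  y_le := h.x_le
  cover u hu v hv := by
    obtain ⟨i, h1, h2, h3, h4⟩ := h.cover v hv u hu
    exact ⟨i, h3, h4, h1, h2⟩
  separated i j hij := by
    rcases h.separated i j hij with h | h | h | h <;> simp [h]

theorem reflect (h : IsSquareTiling x y s) : IsSquareTiling (fun i => 1 - (x i + s i)) y s where
  pos := h.pos
  x_nonneg i := by linarith [h.x_le i]
  y_nonneg := h.y_nonneg
  x_le i := by linarith [h.x_nonneg i]
  y_le := h.y_le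
  cover u hu v hv := by
    obtain ⟨i, h1, h2, h3, h4⟩ := h.cover (1 - u) ⟨by linarith [hu.2], by linarith [hu.1]⟩ v hv
    exact ⟨i, by linarith, by linarith, h3, h4⟩
  separated i j hij := by
    rcases h.separated i j hij with h | h | h | h
    · right; left; linarith
    · left; linarith
    · right; right; left; linarith
    · right; right; right; linarith

/-- The half-open squares `[x i, x i + s i) × [y i, y i + s i)` cover `[0, 1) × [0, 1)`: push the
point slightly up and to the right, and use that there are finitely many squares. -/
theorem exists_cover_Ico [Finite ι] (h : IsSquareTiling x y s) {u v : ℝ} (hu : u ∈ Ico (0 : ℝ) 1)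
    (hv : v ∈ Ico (0 : ℝ) 1) : ∃ i, x i ≤ u ∧ u < x i + s i ∧ y i ≤ v ∧ v < y i + s i := by
  by_contra! hcon
  have hlt : ∀ a b : ℝ, a < b → ∀ᶠ ε in nhdsWithin (0 : ℝ) (Ioi 0), a + ε < b := fun a b hab => by
    filter_upwards [Ioo_mem_nhdsGT (sub_pos.2 hab)] with ε hε
    linarith [hε.2]
  have hfar : ∀ i, ∀ᶠ ε in nhdsWithin (0 : ℝ) (Ioi 0),
      ¬ (x i ≤ u + ε ∧ u + ε ≤ x i + s i ∧ y i ≤ v + ε ∧ v + ε ≤ y i + s i) := fun i => by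
    by_cases h1 : x i ≤ u
    · by_cases h2 : u < x i + s i
      · by_cases h3 : y i ≤ v
        · filter_upwards [self_mem_nhdsWithin] with ε (hε : 0 < ε) hh
          linarith [hcon i h1 h2 h3]
        · filter_upwards [hlt _ _ (not_le.1 h3)] with ε hε hh
          linarith
      · filter_upwards [self_mem_nhdsWithin] with ε (hε : 0 < ε) hh
        linarith
    · filter_upwards [hlt _ _ (not_le.1 h1)] with ε hε hh
      linarith
  obtain ⟨ε, hε, h1, h2, h3⟩ := ((Filter.eventually_all.2 hfar).and
    ((hlt u 1 hu.2).and ((hlt v 1 hv.2).and self_mem_nhdsWithin))).exists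
  have h3 : 0 < ε := h3
  obtain ⟨i, hi⟩ := h.cover (u + ε) ⟨by linarith [hu.1], h1.le⟩ (v + ε) ⟨by linarith [hv.1], h2.le⟩
  exact hε i hi

/-- If a square lies immediately to the left of the point `(u, v)` and another immediately below
it, then `(u, v)` is the lower left corner of a square. -/
theorem exists_corner [Finite ι] (h : IsSquareTiling x y s) {u v : ℝ} (L M : ι)
    (hLx : x L + s L = u) (hL : y L ≤ v) (hL' : v < y L + s L)
    (hMy : y M + s M = v) (hM : x M ≤ u) (hM' : u < x M + s M) : ∃ k, x k = u ∧ y k = v := by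
  obtain ⟨k, h1, h2, h3, h4⟩ := h.exists_cover_Ico (u := u) (v := v)
    ⟨by linarith [h.x_nonneg L, h.pos L], by linarith [h.x_le M]⟩
    ⟨by linarith [h.y_nonneg M, h.pos M], by linarith [h.y_le L]⟩
  have hkL : k ≠ L := by rintro rfl; linarith
  have hkM : k ≠ M := by rintro rfl; linarith
  refine ⟨k, ?_, ?_⟩
  · rcases h.separated k L hkL with h | h | h | h <;> linarith
  · rcases h.separated k M hkM with h | h | h | h <;> linarith

theorem eq_of_inter (h : IsSquareTiling x y s) {i j : ι} (h1 : x i < x j + s j)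
    (h2 : x j < x i + s i) (h3 : y i < y j + s j) (h4 : y j < y i + s i) : i = j := by
  by_contra hij
  rcases h.separated i j hij with h | h | h | h <;> linarith

theorem sum_sq [Fintype ι] (h : IsSquareTiling x y s) : ∑ i, s i ^ 2 = 1 := by
  have hU : ⋃ i, Ico (x i) (x i + s i) ×ˢ Ico (y i) (y i + s i) =
      Ico (0 : ℝ) 1 ×ˢ Ico (0 : ℝ) 1 := by
    ext ⟨u, v⟩
    simp only [mem_iUnion, mem_prod, mem_Ico]
    constructor
    · rintro ⟨i, ⟨h1, h2⟩, h3, h4⟩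
      exact ⟨⟨by linarith [h.x_nonneg i], by linarith [h.x_le i]⟩,
        by linarith [h.y_nonneg i], by linarith [h.y_le i]⟩
    · rintro ⟨hu, hv⟩
      obtain ⟨i, h1, h2, h3, h4⟩ := h.exists_cover_Ico hu hv
      exact ⟨i, ⟨h1, h2⟩, h3, h4⟩
  have hd : Pairwise (Function.onFun Disjoint
      fun i => Ico (x i) (x i + s i) ×ˢ Ico (y i) (y i + s i)) := fun i j hij => by
    refine Set.disjoint_left.2 ?_
    rintro ⟨u, v⟩ ⟨⟨h1, h2⟩, h3, h4⟩ ⟨⟨h5, h6⟩, h7, h8⟩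
    dsimp only at h1 h2 h3 h4 h5 h6 h7 h8
    exact hij (h.eq_of_inter (by linarith) (by linarith) (by linarith) (by linarith))
  have hm := MeasureTheory.measure_iUnion (μ := MeasureTheory.volume) hd
    (fun i => measurableSet_Ico.prod measurableSet_Ico)
  rw [hU, tsum_fintype] at hm
  simp only [MeasureTheory.Measure.volume_eq_prod, MeasureTheory.Measure.prod_prod,
    Real.volume_Ico, add_sub_cancel_left, sub_zero, ENNReal.ofReal_one, mul_one] at hm
  have h2 : ∀ i, ENNReal.ofReal (s i) * ENNReal.ofReal (s i) = ENNReal.ofReal (s i ^ 2) := fun i => by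
    rw [← ENNReal.ofReal_mul (h.pos i).le, sq]
  simp only [h2] at hm
  rw [← ENNReal.ofReal_sum_of_nonneg (fun i _ => sq_nonneg _)] at hm
  exact (ENNReal.ofReal_eq_one.1 hm.symm)

end IsSquareTiling

/-! ### Runs of squares along a side -/

/-- The intervals `[z i, z i + s i]`, for `i` running through the list, are laid end to end from `u`
to `v`. -/
def IsRun {ι : Type*} (z s : ι → ℝ) : ℝ → ℝ → List ι → Prop
  | u, v, [] => u = v
  | u, v, i :: l => z i = u ∧ IsRun z s (u + s i) v l

namespace IsRun

variable {ι : Type*} {z s : ι → ℝ}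

theorem append_iff {u w : ℝ} {l l' : List ι} :
    IsRun z s u w (l ++ l') ↔ ∃ v, IsRun z s u v l ∧ IsRun z s v w l' := by
  induction l generalizing u with
  | nil => simp [IsRun]
  | cons i l ih => simp [IsRun, ih, and_assoc]

theorem reverse {u v : ℝ} {l : List ι} (h : IsRun z s u v l) :
    IsRun (fun i => 1 - (z i + s i)) s (1 - v) (1 - u) l.reverse := by
  induction l generalizing u with
  | nil => simp_all [IsRun]
  | cons i l ih =>
    rw [List.reverse_cons, append_iff]
    refine ⟨_, ih h.2, ?_, ?_⟩
    · simp [h.1]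
    · show _ = _
      ring

theorem add_sum {u v : ℝ} {l : List ι} (h : IsRun z s u v l) : u + (l.map s).sum = v := by
  induction l generalizing u with
  | nil => simpa [IsRun] using h
  | cons i l ih => simpa [add_assoc] using ih h.2

theorem le_and_le {u v : ℝ} {l : List ι} (hs : ∀ i, 0 < s i) (h : IsRun z s u v l) :
    u ≤ v ∧ ∀ i ∈ l, u ≤ z i ∧ z i + s i ≤ v := by
  induction l generalizing u with
  | nil => exact ⟨le_of_eq h, by simp⟩
  | cons i l ih =>
    obtain ⟨h1, h2⟩ := ih h.2
    have h3 := h.1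
    have h4 := hs i
    refine ⟨by linarith, fun j hj => ?_⟩
    rcases List.mem_cons.1 hj with rfl | hj
    · exact ⟨h3.ge, by linarith⟩
    · exact ⟨by linarith [(h2 j hj).1], (h2 j hj).2⟩

theorem nodup {u v : ℝ} {l : List ι} (hs : ∀ i, 0 < s i) (h : IsRun z s u v l) : l.Nodup := by
  induction l generalizing u with
  | nil => simp
  | cons i l ih =>
    refine List.nodup_cons.2 ⟨fun hi => ?_, ih h.2⟩
    linarith [((h.2.le_and_le hs).2 i hi).1, hs i, h.1]

end IsRun

/-- The squares that touch the bottom side form a run from one end of it to the other. -/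
theorem IsSquareTiling.exists_run {ι : Type*} [Finite ι] {x y s : ι → ℝ}
    (h : IsSquareTiling x y s) : ∃ l, IsRun x s 0 1 l ∧ ∀ i ∈ l, y i = 0 := by
  have := Fintype.ofFinite ι
  classical
  have key : ∀ (n : ℕ) (u : ℝ), 0 ≤ u → u ≤ 1 → (u = 0 ∨ ∃ i, y i = 0 ∧ x i + s i = u) →
      (Finset.univ.filter fun i => u ≤ x i).card ≤ n →
      ∃ l, IsRun x s u 1 l ∧ ∀ i ∈ l, y i = 0 := by
    intro n
    induction n with
    | zero =>
      intro u h0 h1 hu hn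
      rcases h1.eq_or_lt with rfl | h1
      · exact ⟨[], rfl, by simp⟩
      exfalso
      have hn := Finset.filter_eq_empty_iff.1 (Finset.card_eq_zero.1 (Nat.le_zero.1 hn))
      obtain ⟨k, k1, k2, k3, k4⟩ := h.exists_cover_Ico ⟨h0, h1⟩ (v := 0) (by simp)
      have k5 := not_le.1 (hn (Finset.mem_univ k))
      rcases hu with rfl | ⟨i, hi, hiu⟩
      · linarith [h.x_nonneg k]
      · have := h.eq_of_inter (i := i) (j := k) (by linarith [h.pos i]) (by linarith)
          (by linarith) (by linarith [h.pos i])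
        subst this; linarith
    | succ n ih =>
      intro u h0 h1 hu hn
      rcases h1.eq_or_lt with rfl | h1
      · exact ⟨[], rfl, by simp⟩
      obtain ⟨k, k1, k2, k3, k4⟩ := h.exists_cover_Ico ⟨h0, h1⟩ (v := 0) (by simp)
      have hy : y k = 0 := le_antisymm k3 (h.y_nonneg k)
      have hx : x k = u := by
        by_contra hne
        have k5 := lt_of_le_of_ne k1 hne
        rcases hu with rfl | ⟨i, hi, hiu⟩
        · linarith [h.x_nonneg k]
        · have := h.eq_of_inter (i := i) (j := k) (by linarith [h.pos i]) (by linarith)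
            (by linarith) (by linarith [h.pos i])
          subst this; linarith
      have hk := h.pos k
      have hlt : (Finset.univ.filter fun i => u + s k ≤ x i).card <
          (Finset.univ.filter fun i => u ≤ x i).card := by
        refine Finset.card_lt_card ((Finset.ssubset_iff_of_subset ?_).2 ⟨k, ?_, ?_⟩)
        · intro i hi
          simp only [Finset.mem_filter, Finset.mem_univ, true_and] at hi ⊢
          linarith
        · simp [hx]
        · simp [hx, hk]
      obtain ⟨l, hl, hl'⟩ := ih (u + s k) (by linarith) (by linarith [h.x_le k])
        (Or.inr ⟨k, hy, by rw [hx]⟩) (by omega)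
      exact ⟨k :: l, ⟨hx, hl⟩, by simpa [hy] using hl'⟩
  exact key _ 0 le_rfl zero_le_one (Or.inl rfl) le_rfl

/-! ### The frame of a tiling -/

/-- The squares along the boundary of a tiling: `A`, `B`, `C`, `D` are the squares in the lower
left, lower right, upper right and upper left corner, and the lists `p`, `q`, `r`, `t` consist of
the squares between the corners on the bottom, right, top and left side, from left to right and
from bottom to top. -/
structure IsFrame {ι : Type*} (x y s : ι → ℝ) (A B C D : ι) (p q r t : List ι) : Prop where
  bottom : IsRun x s 0 1 (A :: (p ++ [B]))
  right : IsRun y s 0 1 (B :: (q ++ [C]))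
  top : IsRun x s 0 1 (D :: (r ++ [C]))
  left : IsRun y s 0 1 (A :: (t ++ [D]))
  bottom_y : ∀ i ∈ A :: (p ++ [B]), y i = 0
  right_x : ∀ i ∈ B :: (q ++ [C]), x i + s i = 1
  top_y : ∀ i ∈ D :: (r ++ [C]), y i + s i = 1
  left_x : ∀ i ∈ A :: (t ++ [D]), x i = 0

theorem IsSquareTiling.exists_frame {ι : Type*} [Finite ι] [Nontrivial ι] {x y s : ι → ℝ}
    (h : IsSquareTiling x y s) : ∃ A B C D p q r t, IsFrame x y s A B C D p q r t := by
  have hs : ∀ i, s i < 1 := fun i => by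
    obtain ⟨j, hj⟩ := exists_ne i
    by_contra! hi
    refine hj (h.eq_of_inter ?_ ?_ ?_ ?_) <;>
      linarith [h.x_nonneg i, h.y_nonneg i, h.x_le i, h.y_le i, h.x_nonneg j, h.y_nonneg j,
        h.x_le j, h.y_le j, h.pos j]
  have split : ∀ (z : ι → ℝ) (l : List ι), IsRun z s 0 1 l →
      ∃ i m j, l = i :: (m ++ [j]) ∧ z i = 0 ∧ z j + s j = 1 := by
    intro z l hl
    rcases l with _ | ⟨i, l⟩
    · simp [IsRun] at hl
    rcases List.eq_nil_or_concat l with rfl | ⟨m, j, rfl⟩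
    · simp only [IsRun] at hl
      linarith [hs i]
    · rw [List.concat_eq_append] at hl ⊢
      obtain ⟨v, -, hv⟩ := IsRun.append_iff.1 hl.2
      exact ⟨i, m, j, rfl, hl.1, by rw [hv.1]; exact hv.2⟩
  have hyr := h.transpose.reflect.transpose
  obtain ⟨l1, hl1, e1⟩ := h.exists_run
  obtain ⟨l2, hl2, e2⟩ := h.reflect.transpose.exists_run
  obtain ⟨l3, hl3, e3⟩ := hyr.exists_run
  obtain ⟨l4, hl4, e4⟩ := h.transpose.exists_run
  obtain ⟨A, p, B, rfl, hA, hB⟩ := split _ _ hl1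
  obtain ⟨B', q, C, rfl, hB', hC⟩ := split _ _ hl2
  obtain ⟨D, r, C', rfl, hD, hC'⟩ := split _ _ hl3
  obtain ⟨A', t, D', rfl, hA', hD'⟩ := split _ _ hl4
  have a1 := e1 A (by simp)
  have a2 := e4 A' (by simp)
  have b1 := e1 B (by simp)
  have b2 := e2 B' (by simp)
  have c1 := e2 C (by simp)
  have c2 := e3 C' (by simp)
  have d1 := e3 D (by simp)
  have d2 := e4 D' (by simp)
  have pos := h.pos
  obtain rfl : A = A' := by
    apply h.eq_of_inter <;> linarith [pos A, pos A']
  obtain rfl : B = B' := by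
    apply h.eq_of_inter <;> linarith [pos B, pos B']
  obtain rfl : C = C' := by
    apply h.eq_of_inter <;> linarith [pos C, pos C']
  obtain rfl : D = D' := by
    apply h.eq_of_inter <;> linarith [pos D, pos D']
  exact ⟨A, B, C, D, p, q, r, t, hl1, hl2, hl3, hl4, e1, fun i hi => by linarith [e2 i hi],
    fun i hi => by linarith [e3 i hi], e4⟩

namespace IsFrame

variable {ι : Type*} {x y s : ι → ℝ} {A B C D : ι} {p q r t : List ι}

theorem transpose (F : IsFrame x y s A B C D p q r t) : IsFrame y x s A D C B t r q p :=
  ⟨F.left, F.top, F.right, F.bottom, F.left_x, F.top_y, F.right_x, F.bottom_y⟩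

theorem reflect (F : IsFrame x y s A B C D p q r t) :
    IsFrame (fun i => 1 - (x i + s i)) y s B A D C p.reverse t r.reverse q where
  bottom := by simpa using F.bottom.reverse
  right := F.left
  top := by simpa using F.top.reverse
  left := F.right
  bottom_y i hi := F.bottom_y i (by simp at hi ⊢; tauto)
  right_x i hi := by linarith [F.left_x i hi]
  top_y i hi := F.top_y i (by simp at hi ⊢; tauto)
  left_x i hi := by linarith [F.right_x i hi]

theorem sum_bottom (F : IsFrame x y s A B C D p q r t) : s A + (p.map s).sum + s B = 1 := by
  simpa [add_assoc] using F.bottom.add_sum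

theorem mem_bottom (F : IsFrame x y s A B C D p q r t) (hs : ∀ i, 0 < s i) {i : ι} (hi : i ∈ p) :
    0 < x i ∧ x i + s i < 1 ∧ y i = 0 := by
  obtain ⟨v, hv, hB⟩ := IsRun.append_iff.1 F.bottom.2
  have h1 := (hv.le_and_le hs).2 i hi
  have h2 : v + s B = 1 := hB.2
  exact ⟨by linarith [hs A], by linarith [hs B], F.bottom_y i (by simp [hi])⟩

theorem nodup_bottom (F : IsFrame x y s A B C D p q r t) (hs : ∀ i, 0 < s i) : p.Nodup := by
  obtain ⟨v, hv, -⟩ := IsRun.append_iff.1 F.bottom.2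
  exact hv.nodup hs

theorem mem_left (F : IsFrame x y s A B C D p q r t) (hs : ∀ i, 0 < s i) {i : ι} (hi : i ∈ t) :
    0 < y i ∧ y i + s i < 1 ∧ x i = 0 :=
  F.transpose.mem_bottom hs hi

theorem mem_right (F : IsFrame x y s A B C D p q r t) (hs : ∀ i, 0 < s i) {i : ι} (hi : i ∈ q) :
    0 < y i ∧ y i + s i < 1 ∧ x i + s i = 1 := by
  have := F.reflect.transpose.mem_bottom hs hi
  exact ⟨this.1, this.2.1, by linarith [this.2.2]⟩

theorem mem_top (F : IsFrame x y s A B C D p q r t) (hs : ∀ i, 0 < s i) {i : ι} (hi : i ∈ r) :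
    0 < x i ∧ x i + s i < 1 ∧ y i + s i = 1 :=
  F.transpose.mem_right hs hi

theorem nodup (F : IsFrame x y s A B C D p q r t) (hs : ∀ i, 0 < s i) :
    ([A, B, C, D] ++ (p ++ q ++ r ++ t)).Nodup := by
  have np := F.nodup_bottom hs
  have nt := F.transpose.nodup_bottom hs
  have nq := F.reflect.transpose.nodup_bottom hs
  have nr := F.transpose.reflect.transpose.nodup_bottom hs
  have hp := fun i => F.mem_bottom hs (i := i)
  have hq := fun i => F.mem_right hs (i := i)
  have hr := fun i => F.mem_top hs (i := i)
  have ht := fun i => F.mem_left hs (i := i)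
  have hA := F.left_x A (by simp)
  have hA' := F.bottom_y A (by simp)
  have hB := F.right_x B (by simp)
  have hB' := F.bottom_y B (by simp)
  have hC := F.right_x C (by simp)
  have hC' := F.top_y C (by simp)
  have hD := F.left_x D (by simp)
  have hD' := F.top_y D (by simp)
  have h1 : ∀ i, i = A ∨ i = B ∨ i = C ∨ i = D → s i < 1 := by
    have hsum : ∀ l : List ι, 0 ≤ (l.map s).sum := fun l =>
      List.sum_nonneg (by simp only [List.mem_map]; rintro _ ⟨i, -, rfl⟩; exact (hs i).le)
    have e1 := F.sum_bottom
    have e2 := F.transpose.reflect.transpose.sum_bottom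
    have hp0 := hsum p
    have hr0 := hsum r
    have := hs A
    have := hs B
    have := hs C
    have := hs D
    rintro i (rfl | rfl | rfl | rfl) <;> linarith
  have sA := h1 A (by simp)
  have sB := h1 B (by simp)
  have sC := h1 C (by simp)
  have sD := h1 D (by simp)
  have key : ∀ (i j : ι), (x i < x j ∨ x j < x i ∨ y i < y j ∨ y j < y i ∨
      x i + s i < x j + s j ∨ x j + s j < x i + s i ∨ y i + s i < y j + s j ∨
      y j + s j < y i + s i) → i ≠ j := by
    rintro i j hij rfl
    simp at hij
  have hcorner : [A, B, C, D].Nodup := by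
    simp only [List.nodup_cons, List.mem_cons, List.not_mem_nil, not_or, or_false, not_false_eq_true,
      List.nodup_nil, and_true]
    refine ⟨⟨?_, ?_, ?_⟩, ⟨?_, ?_⟩, ?_⟩ <;> apply key <;> grind
  refine List.nodup_append.2 ⟨hcorner, List.nodup_append.2 ⟨List.nodup_append.2
    ⟨List.nodup_append.2 ⟨np, nq, ?_⟩, nr, ?_⟩, nt, ?_⟩, ?_⟩ <;>
    intro i hi j hj <;> apply key <;> have hsi := hs i <;> have hsj := hs j
  · have := hp i hi
    have := hq j hj
    grind
  · have := hr j hj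
    rcases List.mem_append.1 hi with hi | hi
    · have := hp i hi
      grind
    · have := hq i hi
      grind
  · have := ht j hj
    rcases List.mem_append.1 hi with hi | hi
    · rcases List.mem_append.1 hi with hi | hi
      · have := hp i hi
        grind
      · have := hq i hi
        grind
    · have := hr i hi
      grind
  · simp only [List.mem_append, List.mem_cons, List.not_mem_nil, or_false] at hi hj
    rcases hj with ((hj | hj) | hj) | hj
    · have := hp j hj
      grind
    · have := hq j hj
      grind
    · have := hr j hj
      grind
    · have := ht j hj
      grind

/-- The squares that are not listed in the frame, as a list `e`. -/
theorem exists_rest [Fintype ι] (F : IsFrame x y s A B C D p q r t) (hs : ∀ i, 0 < s i) :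
    ∃ e : List ι, ([A, B, C, D] ++ (p ++ q ++ r ++ t) ++ e).Nodup ∧
      4 + (p.length + q.length + r.length + t.length) + e.length = Fintype.card ι ∧
      (∀ P : ι → Prop, (∃ i, P i) → ∃ i ∈ [A, B, C, D] ++ (p ++ q ++ r ++ t) ++ e, P i) ∧
      ∀ f : ι → ℝ, ∑ i, f i = (([A, B, C, D] ++ (p ++ q ++ r ++ t) ++ e).map f).sum := by
  classical
  have hn := F.nodup hs
  set L := [A, B, C, D] ++ (p ++ q ++ r ++ t) with hL
  have hn' : (L ++ (Finset.univ \ L.toFinset).toList).Nodup :=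
    List.nodup_append.2 ⟨hn, Finset.nodup_toList _, fun i hi j hj => by
      simp only [Finset.mem_toList, Finset.mem_sdiff, List.mem_toFinset] at hj
      rintro rfl
      exact hj.2 hi⟩
  have hall : ∀ i, i ∈ L ++ (Finset.univ \ L.toFinset).toList := fun i => by
    by_cases hi : i ∈ L <;> simp [hi]
  have huniv : (L ++ (Finset.univ \ L.toFinset).toList).toFinset = Finset.univ := by
    ext i
    simp only [List.mem_toFinset, Finset.mem_univ, hall i]
  refine ⟨_, hn', ?_, fun P ⟨i, hi⟩ => ⟨i, hall i, hi⟩, fun f => ?_⟩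
  · have hlen : L.length = 4 + (p.length + q.length + r.length + t.length) := by
      simp [hL]
      omega
    have hcard := List.toFinset_card_of_nodup hn'
    rw [huniv, Finset.card_univ, List.length_append, hlen] at hcard
    exact hcard.symm
  · rw [← List.sum_toFinset f hn', huniv]

end IsFrame

/-! ### Every side meets three squares -/

section ThreeSquares

variable {x y s : Fin 8 → ℝ} {A B C D P Q R S : Fin 8}

/-- If `P` is smaller than `A`, the point where `A` rises above `P` is the lower left corner of a
square, and only `Q` can be that square. So `Q` has side `1 - s A`, and it lies on top of both `P`
and `B`. -/
theorem IsFrame.eq_of_bottom_lt (h : IsSquareTiling x y s)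
    (F : IsFrame x y s A B C D [P] [Q] [R] [S]) (hPA : s P < s A) :
    s Q = 1 - s A ∧ s B = s P := by
  have pos := h.pos
  obtain ⟨e, -, hlen, hall, -⟩ := F.exists_rest pos
  obtain rfl : e = [] := List.length_eq_zero_iff.1 (by simpa using hlen)
  simp only [List.cons_append, List.nil_append, List.append_nil, List.mem_cons, List.not_mem_nil,
    or_false, exists_eq_or_imp, exists_eq_left] at hall
  obtain ⟨h1, h2, h3, h4, h5, h6, h7, h8⟩ := id F
  simp [IsRun] at h1 h2 h3 h4 h5 h6 h7 h8
  have pP := pos P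
  have pS := pos S
  have pC := pos C
  rcases hall _ (h.exists_corner (u := s A) (v := s P) A P (by linarith) (by linarith)
    (by linarith) (by linarith) (by linarith) (by linarith)) with
    H | H | H | H | H | H | H | H <;>
    first
    | (exfalso; linarith)
    | exact ⟨by linarith, by linarith⟩

/-- By `IsFrame.eq_of_bottom_lt`, also applied to the transposed frame, all sides are determined by
`s A` if `S` is smaller than `A` as well. Then `Q` and `R` do not overlap only if `3 / 5 ≤ s A`, which
is the bound. If `S` is at least as large as `A`, then `R` and `S` overlap. -/
theorem IsFrame.sum_le_of_bottom_lt (h : IsSquareTiling x y s)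
    (F : IsFrame x y s A B C D [P] [Q] [R] [S]) (hPA : s P < s A) : ∑ i, s i ≤ 13 / 5 := by
  have pos := h.pos
  obtain ⟨hQ, hB⟩ := F.eq_of_bottom_lt h hPA
  obtain ⟨e, hn, hlen, -, hsum⟩ := F.exists_rest pos
  obtain rfl : e = [] := List.length_eq_zero_iff.1 (by simpa using hlen)
  have hsum := hsum s
  obtain ⟨h1, h2, h3, h4, h5, h6, h7, h8⟩ := id F
  simp [IsRun] at hsum h1 h2 h3 h4 h5 h6 h7 h8
  rcases lt_or_ge (s S) (s A) with hSA | hSA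
  · obtain ⟨hR, hD⟩ := F.transpose.eq_of_bottom_lt h.transpose hSA
    have hQR : Q ≠ R := by rintro rfl; simp at hn
    rcases h.separated Q R hQR with H | H | H | H <;> linarith
  · have hRS : R ≠ S := by rintro rfl; simp at hn
    have pS := pos S
    have pR := pos R
    have pA := pos A
    have pD := pos D
    rcases h.separated R S hRS with H | H | H | H <;> linarith

/-- By symmetry, `IsFrame.sum_le_of_bottom_lt` leaves the case that no square between two corners is
smaller than its neighbours in the corners. Then all eight squares have side `1 / 3`, and the middle
of the unit square is not covered: the area is too small. -/
theorem IsFrame.sum_le_of_three_squares (h : IsSquareTiling x y s)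
    (F : IsFrame x y s A B C D [P] [Q] [R] [S]) : ∑ i, s i ≤ 13 / 5 := by
  by_contra hcon
  have k1 : s A ≤ s P := not_lt.1 fun hlt => hcon (F.sum_le_of_bottom_lt h hlt)
  have k2 : s A ≤ s S := not_lt.1 fun hlt =>
    hcon (F.transpose.sum_le_of_bottom_lt h.transpose hlt)
  have k3 : s B ≤ s P := not_lt.1 fun hlt => hcon (F.reflect.sum_le_of_bottom_lt h.reflect hlt)
  have k4 : s B ≤ s Q := not_lt.1 fun hlt =>
    hcon (F.reflect.transpose.sum_le_of_bottom_lt h.reflect.transpose hlt)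
  have k5 : s D ≤ s S := not_lt.1 fun hlt =>
    hcon (F.transpose.reflect.sum_le_of_bottom_lt h.transpose.reflect hlt)
  have k6 : s D ≤ s R := not_lt.1 fun hlt =>
    hcon (F.transpose.reflect.transpose.sum_le_of_bottom_lt h.transpose.reflect.transpose hlt)
  have k7 : s C ≤ s R := not_lt.1 fun hlt =>
    hcon (F.transpose.reflect.transpose.reflect.sum_le_of_bottom_lt
      h.transpose.reflect.transpose.reflect hlt)
  have k8 : s C ≤ s Q := not_lt.1 fun hlt =>
    hcon (F.transpose.reflect.transpose.reflect.transpose.sum_le_of_bottom_lt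
      h.transpose.reflect.transpose.reflect.transpose hlt)
  have pos := h.pos
  obtain ⟨e, hn, hlen, -, hsum⟩ := F.exists_rest pos
  obtain rfl : e = [] := List.length_eq_zero_iff.1 (by simpa using hlen)
  have hsq := h.sum_sq
  rw [hsum] at hsq
  obtain ⟨h1, h2, h3, h4, h5, h6, h7, h8⟩ := id F
  simp [IsRun] at hsq h1 h2 h3 h4 h5 h6 h7 h8
  have hPS : P ≠ S := by rintro rfl; simp at hn
  have hPQ : P ≠ Q := by rintro rfl; simp at hn
  have hQR : Q ≠ R := by rintro rfl; simp at hn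
  have hRS : R ≠ S := by rintro rfl; simp at hn
  have pA := pos A
  have pB := pos B
  have pP := pos P
  have pQ := pos Q
  have pR := pos R
  have pS := pos S
  have a1 : 1 / 3 ≤ s A := by rcases h.separated P S hPS with H | H | H | H <;> linarith
  have b1 : 1 / 3 ≤ s B := by rcases h.separated P Q hPQ with H | H | H | H <;> linarith
  have c1 : 1 / 3 ≤ s C := by rcases h.separated Q R hQR with H | H | H | H <;> linarith
  have d1 : 1 / 3 ≤ s D := by rcases h.separated R S hRS with H | H | H | H <;> linarith
  rw [show s A = 1 / 3 by linarith, show s B = 1 / 3 by linarith, show s C = 1 / 3 by linarith,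
    show s D = 1 / 3 by linarith, show s P = 1 / 3 by linarith, show s Q = 1 / 3 by linarith,
    show s R = 1 / 3 by linarith, show s S = 1 / 3 by linarith] at hsq
  norm_num at hsq

end ThreeSquares

/-! ### Two adjacent sides meet two squares each -/

section TwoTwo

variable {x y s : Fin 8 → ℝ} {A B C D : Fin 8} {q r : List (Fin 8)}

/-- The point where the right side of `A` meets the top side of `B` is the lower left corner of a
square, also when these squares have the same size. -/
theorem IsFrame.exists_corner_right (h : IsSquareTiling x y s)
    (F : IsFrame x y s A B C D [] q r []) : ∃ k, x k = s A ∧ y k = s B := by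
  have pA := h.pos A
  have pB := h.pos B
  have pD := h.pos D
  have h1 := F.bottom
  have h4 := F.left
  have h5 := F.bottom_y B (by simp)
  have h6 := F.left_x D (by simp)
  simp [IsRun] at h1 h4
  have hBD : B ≠ D := by
    rintro rfl
    linarith
  have hle : s B ≤ s A := by rcases h.separated B D hBD with H | H | H | H <;> linarith
  rcases hle.lt_or_eq with hlt | heq
  · exact h.exists_corner A B (by linarith) (by linarith) (by linarith) (by linarith) (by linarith)
      (by linarith)
  · exact h.exists_corner D B (by linarith) (by linarith) (by linarith) (by linarith) (by linarith)
      (by linarith)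

theorem IsFrame.exists_corner_top (h : IsSquareTiling x y s)
    (F : IsFrame x y s A B C D [] q r []) : ∃ k, x k = s D ∧ y k = s A := by
  obtain ⟨k, h1, h2⟩ := F.transpose.exists_corner_right h.transpose
  exact ⟨k, h2, h1⟩

/-- No such tiling exists: `E` fills the corner between `A` and `B`, and then no square fits into the
corner between `A` and `D`. -/
theorem IsFrame.sum_le_two_two_one_three {E F₁ F₂ F₃ : Fin 8} (h : IsSquareTiling x y s)
    (F : IsFrame x y s A B C D [] [E] [F₁, F₂, F₃] []) : ∑ i, s i ≤ 13 / 5 := by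
  have pos := h.pos
  obtain ⟨e, -, hlen, hall, -⟩ := F.exists_rest pos
  obtain rfl : e = [] := List.length_eq_zero_iff.1 (by simpa using hlen)
  simp only [List.cons_append, List.nil_append, List.append_nil, List.mem_cons, List.not_mem_nil,
    or_false, exists_eq_or_imp, exists_eq_left] at hall
  obtain ⟨h1, h2, h3, h4, h5, h6, h7, h8⟩ := id F
  simp [IsRun] at h1 h2 h3 h4 h5 h6 h7 h8
  have pB := pos B
  have pC := pos C
  have pE := pos E
  have pF₁ := pos F₁
  have pF₂ := pos F₂
  have pF₃ := pos F₃
  exfalso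
  have hE : s E = s B := by
    rcases hall _ (F.exists_corner_right h) with H | H | H | H | H | H | H | H <;> linarith
  rcases hall _ (F.exists_corner_top h) with H | H | H | H | H | H | H | H <;> linarith

/-- Filling the corners between `A` and `B`, between `A` and `D`, and above `E₁` gives sides
`s E₁ = s F₁ = s E₂ = s B`, and `s B ≤ 1 / 4` since `E₂` and `F₂` do not overlap. -/
theorem IsFrame.sum_le_two_two_two_two {E₁ E₂ F₁ F₂ : Fin 8} (h : IsSquareTiling x y s)
    (F : IsFrame x y s A B C D [] [E₁, E₂] [F₁, F₂] []) : ∑ i, s i ≤ 13 / 5 := by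
  have pos := h.pos
  obtain ⟨e, hn, hlen, hall, hsum⟩ := F.exists_rest pos
  obtain rfl : e = [] := List.length_eq_zero_iff.1 (by simpa using hlen)
  have hsum := hsum s
  simp only [List.cons_append, List.nil_append, List.append_nil, List.mem_cons, List.not_mem_nil,
    or_false, exists_eq_or_imp, exists_eq_left] at hall
  obtain ⟨h1, h2, h3, h4, h5, h6, h7, h8⟩ := id F
  simp [IsRun] at hsum h1 h2 h3 h4 h5 h6 h7 h8
  have pA := pos A
  have pB := pos B
  have pC := pos C
  have pE₁ := pos E₁
  have pE₂ := pos E₂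
  have pF₁ := pos F₁
  have pF₂ := pos F₂
  have hE₁ : s E₁ = s B := by
    rcases hall _ (F.exists_corner_right h) with H | H | H | H | H | H | H | H <;> linarith
  have hF₁ : s F₁ = s B := by
    rcases hall _ (F.exists_corner_top h) with H | H | H | H | H | H | H | H <;> linarith
  have hw : 2 * s B ≤ s A := by
    have hne : E₁ ≠ F₁ := by rintro rfl; simp at hn
    rcases h.separated E₁ F₁ hne with H | H | H | H <;> linarith
  have hcorner : ∃ k, x k = s A ∧ y k = 2 * s B := by
    rcases hw.lt_or_eq with hlt | heq
    · exact h.exists_corner A E₁ (by linarith) (by linarith) (by linarith) (by linarith)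
        (by linarith) (by linarith)
    · exact h.exists_corner F₁ E₁ (by linarith) (by linarith) (by linarith) (by linarith)
        (by linarith) (by linarith)
  have hE₂ : s E₂ = s B := by
    rcases hall _ hcorner with H | H | H | H | H | H | H | H <;> linarith
  have hne : E₂ ≠ F₂ := by rintro rfl; simp at hn
  rcases h.separated E₂ F₂ hne with H | H | H | H <;> linarith

/-- The corner between `A` and `D` is filled by the square `G` off the boundary, and this determines
all sides: the total is `3 - s B`, where `2 / 5 ≤ s B` since `F₂` and `G` do not overlap. -/
theorem IsFrame.sum_le_two_two_one_two {E F₁ F₂ : Fin 8} (h : IsSquareTiling x y s)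
    (F : IsFrame x y s A B C D [] [E] [F₁, F₂] []) : ∑ i, s i ≤ 13 / 5 := by
  have pos := h.pos
  obtain ⟨e, hn, hlen, hall, hsum⟩ := F.exists_rest pos
  obtain ⟨G, rfl⟩ : ∃ G, e = [G] := List.length_eq_one_iff.1 (by simp at hlen; omega)
  have hsum := hsum s
  simp only [List.cons_append, List.nil_append, List.append_nil, List.mem_cons, List.not_mem_nil,
    or_false, exists_eq_or_imp, exists_eq_left] at hall
  obtain ⟨h1, h2, h3, h4, h5, h6, h7, h8⟩ := id F
  simp [IsRun] at hsum h1 h2 h3 h4 h5 h6 h7 h8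
  have pA := pos A
  have pB := pos B
  have pC := pos C
  have pE := pos E
  have pF₁ := pos F₁
  have pF₂ := pos F₂
  have pG := pos G
  have hAC : A ≠ C := by rintro rfl; simp at hn
  have hAE : A ≠ E := by rintro rfl; simp at hn
  have hEG : E ≠ G := by rintro rfl; simp at hn
  have hF₁G : F₁ ≠ G := by rintro rfl; simp at hn
  have hF₂G : F₂ ≠ G := by rintro rfl; simp at hn
  have hBD : B ≠ D := by rintro rfl; simp at hn
  have hle : s B ≤ s A := by rcases h.separated B D hBD with H | H | H | H <;> linarith
  have hC : s C ≤ s B := by rcases h.separated A C hAC with H | H | H | H <;> linarith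
  have hE : s E ≤ s B := by rcases h.separated A E hAE with H | H | H | H <;> linarith
  have hright : s E = s B ∨ x G = s A ∧ y G = s B := by
    rcases hall _ (F.exists_corner_right h) with H | H | H | H | H | H | H | H <;>
      first
      | exact Or.inr H
      | exact Or.inl (by linarith)
  have htop : s F₁ = s B ∨ x G = s D ∧ y G = s A := by
    rcases hall _ (F.exists_corner_top h) with H | H | H | H | H | H | H | H <;>
      first
      | exact Or.inr H
      | exact Or.inl (by linarith)
  -- If `F₁` filled the corner above `A`, then `E` would be too long.
  rcases htop with hF₁ | ⟨xG, yG⟩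
  · linarith
  have hGF₁ : s G + s F₁ ≤ s B := by
    rcases h.separated F₁ G hF₁G with H | H | H | H <;> linarith
  have hGF₁' : s G + s F₁ = s B := by
    rcases hall _ (h.exists_corner (u := s D) (v := s A + s G) D G (by linarith) (by linarith)
      (by linarith) (by linarith) (by linarith) (by linarith)) with
      H | H | H | H | H | H | H | H <;> linarith
  have hEB : s E = s B := by
    rcases hright with hEB | ⟨xG', yG'⟩
    · exact hEB
    -- Here `G` lies in both corners, so that `A`, `B` and `D` have side `1 / 2`.
    · exfalso
      have hGE : s G + s E ≤ s B := by
        rcases h.separated E G hEG with H | H | H | H <;> linarith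
      rcases hall _ (h.exists_corner (u := s A + s G) (v := s B) G B (by linarith) (by linarith)
        (by linarith) (by linarith) (by linarith) (by linarith)) with
        H | H | H | H | H | H | H | H <;> linarith
  have hG : s A ≤ s D + s G := by
    by_contra! hlt
    rcases hall _ (h.exists_corner (u := s D + s G) (v := s A) G A (by linarith) (by linarith)
      (by linarith) (by linarith) (by linarith) (by linarith)) with
      H | H | H | H | H | H | H | H <;> linarith
  have hG' : s D + s G = s A := by
    rcases h.separated E G hEG with H | H | H | H <;> linarith
  rcases h.separated F₂ G hF₂G with H | H | H | H <;> linarith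

/-- The squares `A`, `B`, `D` of side `1 / 2` leave a square of side `1 / 2`, which cannot be tiled
by five squares. -/
theorem IsFrame.side_ne_of_two_two_one_one {E F₁ G H : Fin 8}
    (h : IsSquareTiling x y s) (F : IsFrame x y s A B C D [] [E] [F₁] [])
    (hn : [A, B, C, D, E, F₁, G, H].Nodup)
    (hall : ∀ P : Fin 8 → Prop, (∃ i, P i) → P A ∨ P B ∨ P C ∨ P D ∨ P E ∨ P F₁ ∨ P G ∨ P H)
    (hsq : s A ^ 2 + s B ^ 2 + s C ^ 2 + s D ^ 2 + s E ^ 2 + s F₁ ^ 2 + s G ^ 2 + s H ^ 2 = 1)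
    (xG : x G = s A) (yG : y G = s B) : s A ≠ s B := by
  intro hAB
  obtain ⟨h1, h2, h3, h4, h5, h6, h7, h8⟩ := id F
  simp [IsRun] at h1 h2 h3 h4 h5 h6 h7 h8
  have pos := h.pos
  have pA := pos A
  have pB := pos B
  have pC := pos C
  have pE := pos E
  have pF := pos F₁
  have pG := pos G
  have pH := pos H
  have hEF : E ≠ F₁ := by rintro rfl; simp at hn
  have hGE : G ≠ E := by rintro rfl; simp at hn
  have hGC : G ≠ C := by rintro rfl; simp at hn
  have hHE : H ≠ E := by rintro rfl; simp at hn
  have hHF : H ≠ F₁ := by rintro rfl; simp at hn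
  have hEC : s E ≤ s C := by rcases h.separated E F₁ hEF with K | K | K | K <;> linarith
  have hGE' : s G + s E ≤ s B := by
    rcases h.separated G E hGE with K | K | K | K <;> linarith
  have hright := hall _ (h.exists_corner (u := s A + s G) (v := s B) G B (by linarith)
    (by linarith) (by linarith) (by linarith) (by linarith) (by linarith))
  have hright' : s G + s E = s B ∨ x H = s A + s G ∧ y H = s B := by
    rcases hright with K | K | K | K | K | K | K | K <;>
      first
      | exact Or.inr K
      | exact Or.inl (by linarith)
  have htop' : s G + s E = s B ∨ x H = s D ∧ y H = s A + s G := by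
    rcases hall _ (h.exists_corner (u := s D) (v := s A + s G) D G (by linarith) (by linarith)
      (by linarith) (by linarith) (by linarith) (by linarith)) with
      K | K | K | K | K | K | K | K <;>
      first
      | exact Or.inr K
      | exact Or.inl (by linarith)
  rcases hright' with hGE | hH
  · rcases htop' with - | hH
    · have hGC' : s G ≤ 1 / 4 := by rcases h.separated G C hGC with K | K | K | K <;> linarith
      rw [show s A = 1 / 2 by linarith, show s B = 1 / 2 by linarith,
        show s C = 1 / 4 by linarith, show s D = 1 / 2 by linarith,
        show s E = 1 / 4 by linarith, show s F₁ = 1 / 4 by linarith,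
        show s G = 1 / 4 by linarith] at hsq
      linarith [pow_pos pH 2]
    · rcases h.separated H F₁ hHF with K | K | K | K <;> linarith
  · rcases h.separated H E hHE with K | K | K | K <;>
      rcases htop' with K' | K' <;> linarith

/-- The squares `G` and `H` fill the corners between `A` and `B` and between `A` and `D`. They meet in
the corner of `A`, and the total is `3 - s B`, where `2 / 5 ≤ s B` since `s C ≤ s B`. -/
theorem IsFrame.sum_le_two_two_one_one_of_corners {E F₁ G H : Fin 8}
    (h : IsSquareTiling x y s) (F : IsFrame x y s A B C D [] [E] [F₁] [])
    (hn : [A, B, C, D, E, F₁, G, H].Nodup)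
    (hall : ∀ P : Fin 8 → Prop, (∃ i, P i) → P A ∨ P B ∨ P C ∨ P D ∨ P E ∨ P F₁ ∨ P G ∨ P H)
    (hsum : ∑ i, s i = s A + s B + s C + s D + s E + s F₁ + s G + s H)
    (xG : x G = s A) (yG : y G = s B) (xH : x H = s D) (yH : y H = s A) : ∑ i, s i ≤ 13 / 5 := by
  obtain ⟨h1, h2, h3, h4, h5, h6, h7, h8⟩ := id F
  simp [IsRun] at h1 h2 h3 h4 h5 h6 h7 h8
  have pos := h.pos
  have pA := pos A
  have pB := pos B
  have pC := pos C
  have pE := pos E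
  have pF := pos F₁
  have pG := pos G
  have pH := pos H
  have hAC : A ≠ C := by rintro rfl; simp at hn
  have hEF : E ≠ F₁ := by rintro rfl; simp at hn
  have hBD : B ≠ D := by rintro rfl; simp at hn
  have hGE : G ≠ E := by rintro rfl; simp at hn
  have hHF : H ≠ F₁ := by rintro rfl; simp at hn
  have hGH : G ≠ H := by rintro rfl; simp at hn
  have hle : s B ≤ s A := by rcases h.separated B D hBD with K | K | K | K <;> linarith
  have hC : s C ≤ s B := by rcases h.separated A C hAC with K | K | K | K <;> linarith
  have hEC : s E ≤ s C := by rcases h.separated E F₁ hEF with K | K | K | K <;> linarith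
  have hGE' : s G + s E ≤ s B := by
    rcases h.separated G E hGE with K | K | K | K <;> linarith
  have hright := hall _ (h.exists_corner (u := s A + s G) (v := s B) G B (by linarith)
    (by linarith) (by linarith) (by linarith) (by linarith) (by linarith))
  have hHF' : s H + s F₁ ≤ s B := by
    rcases h.separated H F₁ hHF with K | K | K | K <;> linarith
  have hGB : s G + s E = s B := by
    rcases hright with K | K | K | K | K | K | K | K <;> linarith
  have hHB : s H + s E = s B := by
    rcases hall _ (h.exists_corner (u := s D) (v := s A + s H) D H (by linarith) (by linarith)
      (by linarith) (by linarith) (by linarith) (by linarith)) with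
      K | K | K | K | K | K | K | K <;> linarith
  have hG : s A ≤ s B + s G := by
    by_contra! hlt
    rcases hall _ (h.exists_corner (u := s A) (v := s B + s G) A G (by linarith) (by linarith)
      (by linarith) (by linarith) (by linarith) (by linarith)) with
      K | K | K | K | K | K | K | K <;> linarith
  rcases h.separated G H hGH with K | K | K | K <;> linarith

/-- If `E` fills the corner between `A` and `B`, then all of `B`, `C`, `D`, `E`, `F₁` have side
`1 / 3`, and together with `A` they already have area `1`. -/
theorem IsFrame.right_ne_of_two_two_one_one {E F₁ G H : Fin 8}
    (h : IsSquareTiling x y s) (F : IsFrame x y s A B C D [] [E] [F₁] [])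
    (hn : [A, B, C, D, E, F₁, G, H].Nodup)
    (hsq : s A ^ 2 + s B ^ 2 + s C ^ 2 + s D ^ 2 + s E ^ 2 + s F₁ ^ 2 + s G ^ 2 + s H ^ 2 = 1) :
    s E ≠ s B := by
  intro hE
  obtain ⟨h1, h2, h3, h4, h5, h6, h7, h8⟩ := id F
  simp [IsRun] at h1 h2 h3 h4 h5 h6 h7 h8
  have pA := h.pos A
  have pB := h.pos B
  have pC := h.pos C
  have pE := h.pos E
  have pG := pow_pos (h.pos G) 2
  have pH := pow_pos (h.pos H) 2
  have hAC : A ≠ C := by rintro rfl; simp at hn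
  have hEF : E ≠ F₁ := by rintro rfl; simp at hn
  have hC : s C ≤ s B := by rcases h.separated A C hAC with K | K | K | K <;> linarith
  have hw : 2 * s B ≤ s A := by rcases h.separated E F₁ hEF with K | K | K | K <;> linarith
  rw [show s A = 2 / 3 by linarith, show s B = 1 / 3 by linarith, show s C = 1 / 3 by linarith,
    show s D = 1 / 3 by linarith, show s E = 1 / 3 by linarith,
    show s F₁ = 1 / 3 by linarith] at hsq
  linarith

theorem IsFrame.sum_le_two_two_one_one {E F₁ : Fin 8} (h : IsSquareTiling x y s)
    (F : IsFrame x y s A B C D [] [E] [F₁] []) : ∑ i, s i ≤ 13 / 5 := by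
  obtain ⟨e, hn, hlen, hall, hsum⟩ := F.exists_rest h.pos
  obtain ⟨G₀, H₀, rfl⟩ : ∃ G H, e = [G, H] := List.length_eq_two.1 (by simp at hlen; omega)
  have hn : [A, B, C, D, E, F₁, G₀, H₀].Nodup := hn
  have hsum : ∀ f : Fin 8 → ℝ,
      ∑ i, f i = f A + f B + f C + f D + f E + f F₁ + f G₀ + f H₀ := fun f => by
    rw [hsum]
    simp [add_assoc]
  simp only [List.cons_append, List.nil_append, List.append_nil, List.mem_cons, List.not_mem_nil,
    or_false, exists_eq_or_imp, exists_eq_left] at hall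
  have pA := h.pos A
  have pB := h.pos B
  have pC := h.pos C
  have pE := h.pos E
  have pF := h.pos F₁
  obtain ⟨h1, h2, h3, h4, h5, h6, h7, h8⟩ := id F
  simp [IsRun] at h1 h2 h3 h4 h5 h6 h7 h8
  have key : ∀ G H : Fin 8, [A, B, C, D, E, F₁, G, H].Nodup →
      (∀ f : Fin 8 → ℝ, ∑ i, f i = f A + f B + f C + f D + f E + f F₁ + f G + f H) →
      (∀ P : Fin 8 → Prop, (∃ i, P i) → P A ∨ P B ∨ P C ∨ P D ∨ P E ∨ P F₁ ∨ P G ∨ P H) →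
      x G = s A ∧ y G = s B → ∑ i, s i ≤ 13 / 5 := by
    intro G H hn hsum hall hG
    have hsq := (hsum fun i => s i ^ 2).symm.trans h.sum_sq
    have hE := F.right_ne_of_two_two_one_one h hn hsq
    have hAB := F.side_ne_of_two_two_one_one h hn hall hsq hG.1 hG.2
    clear hsq
    rcases hall _ (F.exists_corner_top h) with K | K | K | K | K | K | K | K
    on_goal 8 => exact F.sum_le_two_two_one_one_of_corners h hn hall (hsum s) hG.1 hG.2 K.1 K.2
    on_goal 7 => exact absurd (by linarith) hAB
    on_goal 6 => exact absurd (by linarith) hE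
    all_goals exfalso; linarith
  have hE := F.right_ne_of_two_two_one_one h hn ((hsum fun i => s i ^ 2).symm.trans h.sum_sq)
  rcases hall _ (F.exists_corner_right h) with K | K | K | K | K | K | K | K
  -- The two squares off the boundary play symmetric roles.
  on_goal 8 =>
    refine key H₀ G₀ ((List.Perm.nodup_iff ?_).1 hn) (fun f => ?_) (fun P hP => ?_) K
    · exact .append_left [A, B, C, D, E, F₁] (.swap _ _ _)
    · rw [hsum]
      ring
    · have := hall P hP
      tauto
  on_goal 7 => exact key G₀ H₀ hn hsum hall K
  on_goal 5 => exact absurd (by linarith) hE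
  all_goals exfalso; linarith

end TwoTwo

/-! ### One side meets two squares -/

section Two

variable {x y s : Fin 8 → ℝ} {A B C D : Fin 8}

/-- The corner between `A` and `B` is filled by the square `G` off the boundary, and the one between
`A` and `S` by `R`. All sides are determined by `s B`, the total is `2 + 3 / 2 * s B`, and `s B ≤ 2 / 5`
since `R` and `G` do not overlap. -/
theorem IsFrame.sum_le_bottom_two_of_lt {Q R S : Fin 8} (h : IsSquareTiling x y s)
    (F : IsFrame x y s A B C D [] [Q] [R] [S]) (hBA : s B < s A) : ∑ i, s i ≤ 13 / 5 := by
  have pos := h.pos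
  obtain ⟨e, hn, hlen, hall, hsum⟩ := F.exists_rest pos
  obtain ⟨G, rfl⟩ : ∃ G, e = [G] := List.length_eq_one_iff.1 (by simp at hlen; omega)
  have hsum := hsum s
  simp only [List.cons_append, List.nil_append, List.mem_cons, List.not_mem_nil,
    or_false, exists_eq_or_imp, exists_eq_left] at hall
  obtain ⟨h1, h2, h3, h4, h5, h6, h7, h8⟩ := id F
  simp [IsRun] at hsum h1 h2 h3 h4 h5 h6 h7 h8
  have pB := pos B
  have pC := pos C
  have pD := pos D
  have pQ := pos Q
  have pR := pos R
  have pS := pos S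
  have pG := pos G
  have hAR : A ≠ R := by rintro rfl; simp at hn
  have hQG : Q ≠ G := by rintro rfl; simp at hn
  have hRG : R ≠ G := by rintro rfl; simp at hn
  have hR : s R ≤ s B := by
    rcases h.separated A R hAR with K | K | K | K <;> linarith
  have hG : x G = s A ∧ y G = s B := by
    rcases hall _ (h.exists_corner (u := s A) (v := s B) A B (by linarith)
      (by linarith) (by linarith) (by linarith) (by linarith) (by linarith)) with
      K | K | K | K | K | K | K | K
    on_goal 8 => exact K
    all_goals exfalso; linarith
  have hGQ : s G + s Q ≤ s B := by
    rcases h.separated Q G hQG with K | K | K | K <;> linarith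
  have hGQ' : s G + s Q = s B := by
    rcases hall _ (h.exists_corner (u := s A + s G) (v := s B) G B (by linarith)
      (by linarith) (by linarith) (by linarith) (by linarith) (by linarith)) with
      K | K | K | K | K | K | K | K <;> linarith
  have hDS : s D = s S ∧ s R = s B := by
    rcases hall _ (h.exists_corner (u := s S) (v := s A) S A (by linarith)
      (by linarith) (by linarith) (by linarith) (by linarith) (by linarith)) with
      K | K | K | K | K | K | K | K <;>
      exact ⟨by linarith, by linarith⟩
  rcases h.separated R G hRG with K | K | K | K <;> linarith

/-- If `A` and `B` have the same side, six squares tile the upper half of the unit square. Following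
the squares that stand on `A` and `B` from left to right shows that this is impossible. -/
theorem IsFrame.side_ne_of_bottom_two {Q R S : Fin 8} (h : IsSquareTiling x y s)
    (F : IsFrame x y s A B C D [] [Q] [R] [S]) : s B ≠ s A := by
  intro hBA
  have pos := h.pos
  obtain ⟨e, hn, hlen, hall, hsum⟩ := F.exists_rest pos
  obtain ⟨G, rfl⟩ : ∃ G, e = [G] := List.length_eq_one_iff.1 (by simp at hlen; omega)
  have hsq := h.sum_sq
  rw [hsum] at hsq
  simp only [List.cons_append, List.nil_append, List.mem_cons, List.not_mem_nil,
    or_false, exists_eq_or_imp, exists_eq_left] at hall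
  obtain ⟨h1, h2, h3, h4, h5, h6, h7, h8⟩ := id F
  simp [IsRun] at hsq h1 h2 h3 h4 h5 h6 h7 h8
  have pB := pos B
  have pC := pos C
  have pD := pos D
  have pQ := pos Q
  have pR := pos R
  have pS := pos S
  have pG := pos G
  have hAR : A ≠ R := by rintro rfl; simp at hn
  have hQR : Q ≠ R := by rintro rfl; simp at hn
  have hRG : R ≠ G := by rintro rfl; simp at hn
  have hR : s R ≤ s B := by
    rcases h.separated A R hAR with K | K | K | K <;> linarith
  have hcorner : (s D = s S ∧ s R = s A) ∨ x G = s S ∧ y G = s A := by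
    clear hsq
    rcases hall _ (h.exists_corner (u := s S) (v := s A) S A (by linarith)
      (by linarith) (by linarith) (by linarith) (by linarith) (by linarith)) with
      K | K | K | K | K | K | K | K
    on_goal 8 => exact Or.inr K
    all_goals exact Or.inl ⟨by linarith, by linarith⟩
  rcases hcorner with ⟨hD, hR'⟩ | hG
  · rw [show s A = 1 / 2 by linarith, show s B = 1 / 2 by linarith, show s C = 1 / 4 by linarith,
      show s D = 1 / 4 by linarith, show s Q = 1 / 4 by linarith, show s R = 1 / 2 by linarith,
      show s S = 1 / 4 by linarith] at hsq
    linarith [pow_pos pG 2]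
  · clear hsq
    have hGy := h.y_le G
    have hcorner : ∃ k, x k = s S + s G ∧ y k = s A := by
      rcases lt_or_ge (s S + s G) (s A) with hlt | hge
      · exact h.exists_corner G A (by linarith) (by linarith) (by linarith) (by linarith)
          (by linarith) (by linarith)
      · exact h.exists_corner G B (by linarith) (by linarith) (by linarith) (by linarith)
          (by linarith) (by linarith)
    have hcases : (s D = s S + s G ∧ s R = s A) ∨ s S + s G = 1 - s Q := by
      rcases hall _ hcorner with K | K | K | K | K | K | K | K
      on_goal 6 => exact Or.inl ⟨by linarith, by linarith⟩
      all_goals exact Or.inr (by linarith)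
    rcases hcases with ⟨hD, hR'⟩ | hQ
    · rcases h.separated Q R hQR with K | K | K | K <;> linarith
    · rcases h.separated R G hRG with K | K | K | K <;> linarith

/-- No such tiling exists: the corner between `A` and `S` forces `s R = s B` and `s D = s S`, and then
the next square to be placed on `B` does not fit. -/
theorem IsFrame.sum_le_bottom_two_of_right_two {Q₁ Q₂ R S : Fin 8} (h : IsSquareTiling x y s)
    (F : IsFrame x y s A B C D [] [Q₁, Q₂] [R] [S]) (hBA : s B ≤ s A) : ∑ i, s i ≤ 13 / 5 := by
  have pos := h.pos
  obtain ⟨e, -, hlen, hall, -⟩ := F.exists_rest pos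
  obtain rfl : e = [] := List.length_eq_zero_iff.1 (by simpa using hlen)
  simp only [List.cons_append, List.nil_append, List.append_nil, List.mem_cons, List.not_mem_nil,
    or_false, exists_eq_or_imp, exists_eq_left] at hall
  obtain ⟨h1, h2, h3, h4, h5, h6, h7, h8⟩ := id F
  simp [IsRun] at h1 h2 h3 h4 h5 h6 h7 h8
  have pB := pos B
  have pC := pos C
  have pD := pos D
  have pQ₁ := pos Q₁
  have pQ₂ := pos Q₂
  have pR := pos R
  have pS := pos S
  exfalso
  have hDS : s D = s S ∧ s R = s B := by
    rcases hall _ (h.exists_corner (u := s S) (v := s A) S A (by linarith)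
      (by linarith) (by linarith) (by linarith) (by linarith) (by linarith)) with
      K | K | K | K | K | K | K | K <;>
      exact ⟨by linarith, by linarith⟩
  rcases hBA.lt_or_eq with hlt | heq
  · rcases hall _ (h.exists_corner (u := s A) (v := s B) A B (by linarith)
      (by linarith) (by linarith) (by linarith) (by linarith) (by linarith)) with
      K | K | K | K | K | K | K | K <;> linarith
  · rcases hall _ (h.exists_corner (u := s D + s R) (v := s B) R B (by linarith)
      (by linarith) (by linarith) (by linarith) (by linarith) (by linarith)) with
      K | K | K | K | K | K | K | K <;> linarith

/-- If `A` is larger than `B`, the total is `2 + 3 / 2 * s B`, and `s B ≤ 2 / 5` since `Q` and `R₁` do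
not overlap. The case `s A = s B` does not occur. -/
theorem IsFrame.sum_le_bottom_two_of_top_two {Q R₁ R₂ S : Fin 8} (h : IsSquareTiling x y s)
    (F : IsFrame x y s A B C D [] [Q] [R₁, R₂] [S]) (hBA : s B ≤ s A) : ∑ i, s i ≤ 13 / 5 := by
  have pos := h.pos
  obtain ⟨e, hn, hlen, hall, hsum⟩ := F.exists_rest pos
  obtain rfl : e = [] := List.length_eq_zero_iff.1 (by simpa using hlen)
  have hsum := hsum s
  simp only [List.cons_append, List.nil_append, List.append_nil, List.mem_cons, List.not_mem_nil,
    or_false, exists_eq_or_imp, exists_eq_left] at hall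
  obtain ⟨h1, h2, h3, h4, h5, h6, h7, h8⟩ := id F
  simp [IsRun] at hsum h1 h2 h3 h4 h5 h6 h7 h8
  have pB := pos B
  have pC := pos C
  have pD := pos D
  have pQ := pos Q
  have pR₁ := pos R₁
  have pR₂ := pos R₂
  have pS := pos S
  have hcorner : (s D = s S ∧ s R₁ = s B) ∨ (s D + s R₁ = s S ∧ s R₂ = s B) := by
    rcases hall _ (h.exists_corner (u := s S) (v := s A) S A (by linarith)
      (by linarith) (by linarith) (by linarith) (by linarith) (by linarith)) with
      K | K | K | K | K | K | K | K
    on_goal 7 => exact Or.inr ⟨by linarith, by linarith⟩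
    all_goals exact Or.inl ⟨by linarith, by linarith⟩
  rcases hBA.lt_or_eq with hlt | heq
  · have hQ : s Q = s B := by
      rcases hall _ (h.exists_corner (u := s A) (v := s B) A B (by linarith)
        (by linarith) (by linarith) (by linarith) (by linarith) (by linarith)) with
        K | K | K | K | K | K | K | K <;> linarith
    have hQR₁ : Q ≠ R₁ := by rintro rfl; simp at hn
    rcases hcorner with ⟨hD, hR₁⟩ | ⟨hD, hR₂⟩
    · rcases h.separated Q R₁ hQR₁ with K | K | K | K <;> linarith
    · linarith
  · exfalso
    rcases hcorner with ⟨hD, hR₁⟩ | ⟨hD, hR₂⟩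
    · rcases hall _ (h.exists_corner (u := s D + s R₁) (v := s B) R₁ B (by linarith)
        (by linarith) (by linarith) (by linarith) (by linarith) (by linarith)) with
        K | K | K | K | K | K | K | K <;> linarith
    · rcases hall _ (h.exists_corner (u := s S + s R₂) (v := s B) R₂ B (by linarith)
        (by linarith) (by linarith) (by linarith) (by linarith) (by linarith)) with
        K | K | K | K | K | K | K | K <;> linarith

/-- No such tiling exists: the corner between `A` and `S₁` forces `s R = s B` and `s D = s S₁`, and
then the next square to be placed on `B` does not fit. -/
theorem IsFrame.sum_le_bottom_two_of_left_two {Q R S₁ S₂ : Fin 8} (h : IsSquareTiling x y s)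
    (F : IsFrame x y s A B C D [] [Q] [R] [S₁, S₂]) (hBA : s B ≤ s A) : ∑ i, s i ≤ 13 / 5 := by
  have pos := h.pos
  obtain ⟨e, -, hlen, hall, -⟩ := F.exists_rest pos
  obtain rfl : e = [] := List.length_eq_zero_iff.1 (by simpa using hlen)
  simp only [List.cons_append, List.nil_append, List.append_nil, List.mem_cons, List.not_mem_nil,
    or_false, exists_eq_or_imp, exists_eq_left] at hall
  obtain ⟨h1, h2, h3, h4, h5, h6, h7, h8⟩ := id F
  simp [IsRun] at h1 h2 h3 h4 h5 h6 h7 h8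
  have pB := pos B
  have pC := pos C
  have pD := pos D
  have pQ := pos Q
  have pR := pos R
  have pS₁ := pos S₁
  have pS₂ := pos S₂
  exfalso
  have hDS : s D = s S₁ ∧ s R = s B := by
    rcases hall _ (h.exists_corner (u := s S₁) (v := s A) S₁ A (by linarith)
      (by linarith) (by linarith) (by linarith) (by linarith) (by linarith)) with
      K | K | K | K | K | K | K | K <;>
      exact ⟨by linarith, by linarith⟩
  rcases hBA.lt_or_eq with hlt | heq
  · rcases hall _ (h.exists_corner (u := s A) (v := s B) A B (by linarith)
      (by linarith) (by linarith) (by linarith) (by linarith) (by linarith)) with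
      K | K | K | K | K | K | K | K <;> linarith
  · rcases hall _ (h.exists_corner (u := s D + s R) (v := s B) R B (by linarith)
      (by linarith) (by linarith) (by linarith) (by linarith) (by linarith)) with
      K | K | K | K | K | K | K | K <;> linarith

end Two

/-! ### The upper bound -/

section UpperBound

variable {x y s : Fin 8 → ℝ} {A B C D : Fin 8} {p q r t : List (Fin 8)}

/-- At most four of the eight squares lie between the corners on the boundary. -/
theorem IsFrame.length_le (h : IsSquareTiling x y s) (F : IsFrame x y s A B C D p q r t) :
    p.length + q.length + r.length + t.length ≤ 4 := by
  obtain ⟨e, -, hlen, -, -⟩ := F.exists_rest h.pos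
  rw [Fintype.card_fin] at hlen
  omega

/-- If two opposite sides meet two squares each, then the four corner squares have side `1 / 2`,
and there is no room for a fifth square. -/
theorem IsFrame.false_of_opposite (h : IsSquareTiling x y s)
    (F : IsFrame x y s A B C D [] q [] t) : False := by
  have hnn : ∀ l : List (Fin 8), 0 ≤ (l.map s).sum := fun l =>
    List.sum_nonneg (by simp only [List.mem_map]; rintro _ ⟨i, -, rfl⟩; exact (h.pos i).le)
  have h1 := F.bottom
  have h2 := F.top
  have h3 := F.transpose.sum_bottom
  have h4 := F.reflect.transpose.sum_bottom
  have xA := F.left_x A (by simp)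
  have yA := F.bottom_y A (by simp)
  have xB := F.right_x B (by simp)
  have yB := F.bottom_y B (by simp)
  have xC := F.right_x C (by simp)
  have yC := F.top_y C (by simp)
  have xD := F.left_x D (by simp)
  have yD := F.top_y D (by simp)
  have hq := hnn q
  have ht := hnn t
  have hn := F.nodup h.pos
  have hAC : A ≠ C := by rintro rfl; simp at hn
  have hBD : B ≠ D := by rintro rfl; simp at hn
  simp [IsRun] at h1 h2
  have sA : s A ≤ 1 / 2 := by rcases h.separated A C hAC with H | H | H | H <;> linarith
  have sB : s B ≤ 1 / 2 := by rcases h.separated B D hBD with H | H | H | H <;> linarith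
  obtain ⟨i, hi⟩ : ∃ i, i ∉ ({A, B, C, D} : Finset (Fin 8)) := by
    by_contra! hall
    have := Finset.card_le_four (a := A) (b := B) (c := C) (d := D)
    rw [(Finset.eq_univ_iff_forall.2 hall)] at this
    simp at this
  simp only [Finset.mem_insert, Finset.mem_singleton, not_or] at hi
  obtain ⟨iA, iB, iC, iD⟩ := hi
  have pi := h.pos i
  have hx := h.x_nonneg i
  have hy := h.y_nonneg i
  have hx' := h.x_le i
  have hy' := h.y_le i
  rcases lt_or_ge (x i) (1 / 2) with hxi | hxi <;> rcases lt_or_ge (y i) (1 / 2) with hyi | hyi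
  · exact iA (h.eq_of_inter (by linarith) (by linarith) (by linarith) (by linarith))
  · exact iD (h.eq_of_inter (by linarith) (by linarith) (by linarith) (by linarith))
  · exact iB (h.eq_of_inter (by linarith) (by linarith) (by linarith) (by linarith))
  · exact iC (h.eq_of_inter (by linarith) (by linarith) (by linarith) (by linarith))

/-- If three sides meet two squares each, then so does the fourth: all four corner sums are equal. -/
theorem IsFrame.false_of_three_sides (h : IsSquareTiling x y s)
    (F : IsFrame x y s A B C D [] [] r []) : False := by
  have h1 := F.sum_bottom
  have h2 := F.transpose.sum_bottom
  have h3 := F.reflect.transpose.sum_bottom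
  have h4 := F.transpose.reflect.transpose.sum_bottom
  rcases r with _ | ⟨i, r⟩
  · exact F.false_of_opposite h
  · have hnn : 0 ≤ (r.map s).sum :=
      List.sum_nonneg (by simp only [List.mem_map]; rintro _ ⟨i, -, rfl⟩; exact (h.pos i).le)
    have pi := h.pos i
    simp at h1 h2 h3 h4
    linarith

theorem IsFrame.sum_le_of_adjacent (h : IsSquareTiling x y s)
    (F : IsFrame x y s A B C D [] q r []) : ∑ i, s i ≤ 13 / 5 := by
  have hlen := F.length_le h
  rcases q with _ | ⟨a, _ | ⟨b, _ | ⟨c, q⟩⟩⟩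
  · exact (F.false_of_three_sides h).elim
  · rcases r with _ | ⟨a', _ | ⟨b', _ | ⟨c', _ | ⟨d', r⟩⟩⟩⟩
    · exact (F.transpose.false_of_three_sides h.transpose).elim
    · exact F.sum_le_two_two_one_one h
    · exact F.sum_le_two_two_one_two h
    · exact F.sum_le_two_two_one_three h
    · simp at hlen
      omega
  · rcases r with _ | ⟨a', _ | ⟨b', _ | ⟨c', r⟩⟩⟩
    · exact (F.transpose.false_of_three_sides h.transpose).elim
    · exact F.transpose.sum_le_two_two_one_two h.transpose
    · exact F.sum_le_two_two_two_two h
    · simp at hlen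
      omega
  · rcases r with _ | ⟨a', _ | ⟨b', r⟩⟩
    · exact (F.transpose.false_of_three_sides h.transpose).elim
    · rcases q with _ | ⟨d, q⟩
      · exact F.transpose.sum_le_two_two_one_three h.transpose
      · simp at hlen
        omega
    · simp at hlen
      omega

theorem IsFrame.sum_le_of_bottom_two (h : IsSquareTiling x y s)
    (F : IsFrame x y s A B C D [] q r t) : ∑ i, s i ≤ 13 / 5 := by
  wlog hBA : s B ≤ s A generalizing x y A B C D q r t
  · exact this h.reflect F.reflect (le_of_not_ge hBA)
  have hlen := F.length_le h
  rcases r with _ | ⟨a, r⟩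
  · exact (F.false_of_opposite h).elim
  rcases t with _ | ⟨b, t⟩
  · exact F.sum_le_of_adjacent h
  rcases q with _ | ⟨c, q⟩
  · exact F.reflect.sum_le_of_adjacent h.reflect
  rcases r with _ | ⟨a', r⟩
  · rcases t with _ | ⟨b', t⟩
    · rcases q with _ | ⟨c', _ | ⟨c'', q⟩⟩
      · exact F.sum_le_bottom_two_of_lt h (lt_of_le_of_ne hBA (F.side_ne_of_bottom_two h))
      · exact F.sum_le_bottom_two_of_right_two h hBA
      · simp at hlen
        omega
    · obtain rfl : q = [] := List.length_eq_zero_iff.1 (by simp at hlen; omega)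
      obtain rfl : t = [] := List.length_eq_zero_iff.1 (by simp at hlen; omega)
      exact F.sum_le_bottom_two_of_left_two h hBA
  · obtain rfl : q = [] := List.length_eq_zero_iff.1 (by simp at hlen; omega)
    obtain rfl : r = [] := List.length_eq_zero_iff.1 (by simp at hlen; omega)
    obtain rfl : t = [] := List.length_eq_zero_iff.1 (by simp at hlen; omega)
    exact F.sum_le_bottom_two_of_top_two h hBA

theorem IsSquareTiling.sum_le (h : IsSquareTiling x y s) : ∑ i, s i ≤ 13 / 5 := by
  obtain ⟨A, B, C, D, p, q, r, t, F⟩ := h.exists_frame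
  have hlen := F.length_le h
  rcases p with _ | ⟨P, p⟩
  · exact F.sum_le_of_bottom_two h
  rcases t with _ | ⟨S, t⟩
  · exact F.transpose.sum_le_of_bottom_two h.transpose
  rcases q with _ | ⟨Q, q⟩
  · exact F.reflect.transpose.sum_le_of_bottom_two h.reflect.transpose
  rcases r with _ | ⟨R, r⟩
  · exact F.transpose.reflect.transpose.sum_le_of_bottom_two h.transpose.reflect.transpose
  obtain rfl : p = [] := List.length_eq_zero_iff.1 (by simp at hlen; omega)
  obtain rfl : q = [] := List.length_eq_zero_iff.1 (by simp at hlen; omega)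
  obtain rfl : r = [] := List.length_eq_zero_iff.1 (by simp at hlen; omega)
  obtain rfl : t = [] := List.length_eq_zero_iff.1 (by simp at hlen; omega)
  exact F.sum_le_of_three_squares h

end UpperBound

/-! ### A tiling with total side length `13 / 5` -/

/-- The tiling by one square of side `3 / 5`, three of side `2 / 5` and four of side `1 / 5`: the
large square is in the lower left corner, the squares of side `2 / 5` are in the other corners. -/
noncomputable def eightTiling : Fin 8 → Tile :=
  ![⟨0, 0, 3 / 5, by norm_num⟩, ⟨3 / 5, 0, 2 / 5, by norm_num⟩, ⟨0, 3 / 5, 2 / 5, by norm_num⟩,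
    ⟨3 / 5, 3 / 5, 2 / 5, by norm_num⟩, ⟨3 / 5, 2 / 5, 1 / 5, by norm_num⟩,
    ⟨4 / 5, 2 / 5, 1 / 5, by norm_num⟩, ⟨2 / 5, 3 / 5, 1 / 5, by norm_num⟩,
    ⟨2 / 5, 4 / 5, 1 / 5, by norm_num⟩]

theorem eightTiling_disjoint : Pairwise fun i j =>
    Disjoint (interior (eightTiling i).region) (interior (eightTiling j).region) := by
  intro i j hij
  refine Set.disjoint_left.2 ?_
  rintro ⟨u, v⟩ hi hj
  simp only [Tile.region, interior_prod_eq, interior_Icc, mem_prod, mem_Ioo] at hi hj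
  revert hij hi hj
  fin_cases i <;> fin_cases j <;> simp [eightTiling] <;> intros <;> linarith

theorem eightTiling_bounds (i : Fin 8) : 0 ≤ (eightTiling i).x ∧ 0 ≤ (eightTiling i).y ∧
    (eightTiling i).x + (eightTiling i).side ≤ 1 ∧
    (eightTiling i).y + (eightTiling i).side ≤ 1 := by
  fin_cases i <;> norm_num [eightTiling]

theorem eightTiling_cover {u v : ℝ} (hu0 : 0 ≤ u) (hu1 : u ≤ 1) (hv0 : 0 ≤ v) (hv1 : v ≤ 1) :
    ∃ i, (u, v) ∈ (eightTiling i).region := by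
  have cover : ∀ i : Fin 8, (eightTiling i).x ≤ u → u ≤ (eightTiling i).x + (eightTiling i).side →
      (eightTiling i).y ≤ v → v ≤ (eightTiling i).y + (eightTiling i).side →
      ∃ i, (u, v) ∈ (eightTiling i).region := fun i h1 h2 h3 h4 => ⟨i, ⟨h1, h2⟩, h3, h4⟩
  rcases le_total u (3 / 5) with hu | hu <;> rcases le_total v (3 / 5) with hv | hv
  · apply cover 0 <;> simp [eightTiling] <;> linarith
  · rcases le_total u (2 / 5) with hu' | hu'
    · apply cover 2 <;> simp [eightTiling] <;> linarith
    · rcases le_total v (4 / 5) with hv' | hv'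
      · apply cover 6 <;> simp [eightTiling] <;> linarith
      · apply cover 7 <;> simp [eightTiling] <;> linarith
  · rcases le_total v (2 / 5) with hv' | hv'
    · apply cover 1 <;> simp [eightTiling] <;> linarith
    · rcases le_total u (4 / 5) with hu' | hu'
      · apply cover 4 <;> simp [eightTiling] <;> linarith
      · apply cover 5 <;> simp [eightTiling] <;> linarith
  · apply cover 3 <;> simp [eightTiling] <;> linarith

theorem isTiling_eightTiling : IsTiling eightTiling where
  disjoint_interior := eightTiling_disjoint
  iUnion_eq := by
    ext ⟨u, v⟩
    rw [mem_iUnion]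
    constructor
    · rintro ⟨i, hu, hv⟩
      obtain ⟨h1, h2, h3, h4⟩ := eightTiling_bounds i
      exact ⟨⟨h1.trans hu.1, hu.2.trans h3⟩, h2.trans hv.1, hv.2.trans h4⟩
    · rintro ⟨hu, hv⟩
      exact eightTiling_cover hu.1 hu.2 hv.1 hv.2

theorem totalSide_eightTiling : totalSide eightTiling = 13 / 5 := by
  norm_num [totalSide, eightTiling, Fin.sum_univ_succ]

theorem mainTheorem1 : IsGreatest (tilingSums 8) (psi3 8) ∧ psi3 8 = 13 / 5 := by
  have hgreatest : IsGreatest (tilingSums 8) (13 / 5) := by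
    refine ⟨⟨eightTiling, isTiling_eightTiling, totalSide_eightTiling⟩, ?_⟩
    rintro σ ⟨C, hC, rfl⟩
    exact hC.isSquareTiling.sum_le
  have hpsi : psi3 8 = 13 / 5 := hgreatest.csSup_eq
  exact ⟨hpsi ▸ hgreatest, hpsi⟩
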